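/- Call a topological abelian group unitarily representable if it is topologically isomorphic to a subgroup of the unitary group of some complex Hilbert space, the unitary group carrying the strong operator topology. For a Banach space $E$, let $\tau_k(E)$ denote the topology of uniform convergence on the norm-compact subsets of $E$. (1) Let $A$ be a commutative (complex, not necessarily unital) $C^\ast$-algebra with Banach space dual $A^\ast$. Then the additive group of $A^\ast$ with the topology $\tau_k(A)$ is unitarily representable. (2) Let $\mathscr M$ be a commutative von Neumann algebra with predual $\mathscr M_\ast$, its elements being regarded as functionals on $\mathscr M$. Then the additive group of $\mathscr M_\ast$ with the topology $\tau_k(\mathscr M)$ is unitarily representable. This holds both when $\mathscr M$ is an abstract von Neumann algebra, that is, a commutative unital $C^\ast$-algebra isometrically isomorphic as a complex Banach space to the dual of a Banach space $\mathscr M_\ast$, and when $\mathscr M$ is an algebra of operators on a Hilbert space $H$ that is closed under adjoints and equal to its double commutant, $\mathscr M_\ast$ being then the norm closure in $\mathscr M^\ast$ of the linear span of the functionals $a\mapsto\langle a\eta,\xi\rangle$ with $\xi,\eta\in H$. -/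

import Mathlib

open scoped InnerProductSpace

universe u

/-- The strong operator topology on the unitary group of a Hilbert space `H`: the topology of
pointwise convergence on `H` (with its norm topology). -/
@[reducible]
noncomputable def strongOperatorTopology (H : Type*) [NormedAddCommGroup H] [InnerProductSpace ℂ H]
    [CompleteSpace H] : TopologicalSpace (unitary (H →L[ℂ] H)) :=
  TopologicalSpace.induced (fun U => (⇑(U : H →L[ℂ] H) : H → H))
    Pi.topologicalSpace

/-- The additive group `G` with the topology `t` is unitarily representable: it is topologically
isomorphic to a subgroup of the unitary group, in its strong operator topology, of some complex
Hilbert space. (A group that embeds in this way for a Hilbert space in some universe also does for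
one in its own universe, so that fixing the universe is no restriction.) -/
def IsUnitarilyRepresentable (G : Type u) [AddGroup G] (t : TopologicalSpace G) : Prop :=
  ∃ (H : Type u) (_ : NormedAddCommGroup H) (_ : InnerProductSpace ℂ H) (_ : CompleteSpace H)
    (π : Multiplicative G →* unitary (H →L[ℂ] H)),
    @Topology.IsEmbedding G (unitary (H →L[ℂ] H)) t (strongOperatorTopology H)
      (fun g => π (Multiplicative.ofAdd g))

/-- The topology `τ_k(E)` of uniform convergence on the compact subsets of `E`, on a space `X`
whose elements act as scalar functions on `E` through the pairing `β`. -/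
@[reducible]
noncomputable def tauK {X E : Type*} [TopologicalSpace E] (β : X → E → ℂ) : TopologicalSpace X :=
  TopologicalSpace.induced (fun x => UniformOnFun.ofFun {K : Set E | IsCompact K} (β x))
    (UniformOnFun.topologicalSpace E ℂ {K : Set E | IsCompact K})

/-- The predual of a von Neumann algebra `M` acting on `H`: the norm closure, in the Banach space
dual of `M`, of the linear span of the vector functionals `a ↦ ⟪ξ, a η⟫`. These are
exactly the normal (ultraweakly continuous) functionals on `M`. -/
noncomputable def vonNeumannPredual {H : Type*} [NormedAddCommGroup H] [InnerProductSpace ℂ H]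
    [CompleteSpace H] (M : VonNeumannAlgebra H) :
    Submodule ℂ (StrongDual ℂ M.toStarSubalgebra) :=
  (Submodule.span ℂ {φ : StrongDual ℂ M.toStarSubalgebra |
    ∃ ξ η : H, ∀ a : M.toStarSubalgebra, φ a = ⟪ξ, (a : H →L[ℂ] H) η⟫_ℂ}).topologicalClosure

/-! A group is unitarily representable once continuous positive definite functions generate its
Hausdorff topology: the completed kernel space turns each such function into a matrix coefficient.
So it suffices to generate `tauK` by seminorms of `ℓ¹` type, since `exp (-∑ |s_j - t_j|)` is a
positive semidefinite kernel.

Such seminorms come from `C(Ω)`. A partition of unity spans a contractive image of `ℓ^∞(m)`, and a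
compact set lies close to such spans. Iterating with geometric errors
(`HasSupApproximation.exists_hasSum`) puts every compact set inside a compact image of a countable
product of discs. The supremum of `|θ|` over that image is a weighted `ℓ¹` norm of values of `θ`
(`HasSupApproximation.exists_summable_abs`).

Gelfand duality covers unital algebras, unitization the others. Preduals need only an injective
additive map into the dual. -/

section

open scoped ComplexOrder ENNReal Topology
open MeasureTheory

/-! ### Positive semidefinite kernels. -/

theorem Matrix.posSemidef_gram_complex {S E : Type*} [SeminormedAddCommGroup E]
    [InnerProductSpace ℂ E] (v : S → E) : (Matrix.gram ℂ v).PosSemidef := by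
  refine ⟨Matrix.isHermitian_gram ℂ v, fun x => ?_⟩
  have h : (x.sum fun s a => x.sum fun t b => star a * Matrix.gram ℂ v s t * b) =
      ⟪x.sum fun s a => a • v s, x.sum fun s a => a • v s⟫_ℂ := by
    simp only [Finsupp.sum, sum_inner, inner_sum, inner_smul_left, inner_smul_right,
      Matrix.gram_apply, Finset.mul_sum]
    rw [Finset.sum_comm]
    refine Finset.sum_congr rfl fun s _ => Finset.sum_congr rfl fun t _ => ?_
    simp only [RCLike.star_def]
    ring
  rw [h, inner_self_eq_norm_sq_to_K]
  exact (Complex.zero_le_real.2 (sq_nonneg ‖x.sum fun s a => a • v s‖)).trans_eq (by simp)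

/-- Gram kernel of the vectors `e^{-t} 1_{(0, e^{2t}]}` in `L²(ℝ)`: their inner products are
`e^{-s-t} min(e^{2s}, e^{2t})`, and `-s - t + 2 min(s, t) = -|s - t|`. -/
theorem posSemidef_exp_neg_abs_sub :
    (Matrix.of fun s t : ℝ => ((Real.exp (-|s - t|) : ℝ) : ℂ)).PosSemidef := by
  have hfin (t : ℝ) : volume (Set.Ioc 0 (Real.exp (2 * t))) ≠ ∞ := by simp
  let v : ℝ → Lp ℂ 2 (volume : Measure ℝ) := fun t =>
    ((Real.exp (-t) : ℝ) : ℂ) • indicatorConstLp 2 measurableSet_Ioc (hfin t) (1 : ℂ)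
  suffices h : (Matrix.of fun s t : ℝ => ((Real.exp (-|s - t|) : ℝ) : ℂ)) = Matrix.gram ℂ v from
    h ▸ Matrix.posSemidef_gram_complex v
  ext s t
  have hmin : Real.exp (2 * s) ⊓ Real.exp (2 * t) = Real.exp (2 * (s ⊓ t)) := by
    rcases le_total s t with h | h
    · rw [inf_eq_left.2 h, inf_eq_left.2 (Real.exp_le_exp.2 (by linarith))]
    · rw [inf_eq_right.2 h, inf_eq_right.2 (Real.exp_le_exp.2 (by linarith))]
  have habs : -|s - t| = -s + -t + 2 * (s ⊓ t) := by
    rcases le_total s t with h | h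
    · rw [inf_eq_left.2 h, abs_of_nonpos (by linarith)]; ring
    · rw [inf_eq_right.2 h, abs_of_nonneg (by linarith)]; ring
  simp only [Matrix.of_apply, Matrix.gram_apply, v, inner_smul_left, inner_smul_right,
    L2.inner_indicatorConstLp_indicatorConstLp]
  rw [Set.Ioc_inter_Ioc, sup_idem, hmin, Measure.real, Real.volume_Ioc, sub_zero,
    ENNReal.toReal_ofReal (Real.exp_pos _).le, habs, Real.exp_add, Real.exp_add, Complex.conj_ofReal]
  simp [mul_assoc, mul_left_comm]

theorem Matrix.PosSemidef.of_tendsto {S ι : Type*} {l : Filter ι} [l.NeBot]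
    {A : ι → Matrix S S ℂ} {B : Matrix S S ℂ} (hA : ∀ i, (A i).PosSemidef)
    (h : ∀ s t, Filter.Tendsto (fun i => A i s t) l (nhds (B s t))) : B.PosSemidef := by
  refine ⟨?_, fun x => ?_⟩
  · ext s t
    refine tendsto_nhds_unique (l := l) ?_ (h s t)
    simp_rw [← fun i => (hA i).isHermitian.apply s t]
    exact (continuous_star.tendsto _).comp (h t s)
  · refine ge_of_tendsto' (x := l)
      (f := fun i => x.sum fun s xs => x.sum fun t xt => star xs * A i s t * xt)
      ?_ fun i => (hA i).2 x
    exact tendsto_finsetSum _ fun s _ => tendsto_finsetSum _ fun t _ =>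
      ((h s t).const_mul _).mul_const _

/-- Finite partial sums give Schur products of one-variable kernels; the full sum is their pointwise
limit. -/
theorem posSemidef_exp_neg_tsum_abs_sub {S J : Type*} (ψ : S → J → ℝ)
    (hψ : ∀ s t, Summable fun j => |ψ s j - ψ t j|) :
    (Matrix.of fun s t => ((Real.exp (-∑' j, |ψ s j - ψ t j|) : ℝ) : ℂ)).PosSemidef := by
  classical
  have hfin (F : Finset J) :
      (Matrix.of fun s t => ((Real.exp (-∑ j ∈ F, |ψ s j - ψ t j|) : ℝ) : ℂ)).PosSemidef := by
    induction F using Finset.induction_on with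
    | empty =>
      have h := Matrix.posSemidef_gram_complex fun _ : S => (1 : ℂ)
      have he : (Matrix.of fun s t =>
          ((Real.exp (-∑ j ∈ (∅ : Finset J), |ψ s j - ψ t j|) : ℝ) : ℂ)) =
          Matrix.gram ℂ fun _ : S => (1 : ℂ) := by
        ext s t
        simp [Matrix.gram_apply]
      rwa [he]
    | insert j F hj ih =>
      have h := (posSemidef_exp_neg_abs_sub.submatrix fun s => ψ s j).hadamard ih
      have he : (Matrix.of fun s t =>
          ((Real.exp (-∑ i ∈ insert j F, |ψ s i - ψ t i|) : ℝ) : ℂ)) =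
          Matrix.hadamard ((Matrix.of fun s t : ℝ => ((Real.exp (-|s - t|) : ℝ) : ℂ)).submatrix
            (fun s => ψ s j) (fun s => ψ s j))
          (Matrix.of fun s t => ((Real.exp (-∑ j ∈ F, |ψ s j - ψ t j|) : ℝ) : ℂ)) := by
        ext s t
        simp [Finset.sum_insert hj, Complex.exp_add, add_comm]
      rwa [he]
  refine Matrix.PosSemidef.of_tendsto hfin (l := Filter.atTop) fun s t => ?_
  exact (Complex.continuous_ofReal.tendsto _).comp ((Real.continuous_exp.tendsto _).comp
    (Filter.Tendsto.neg (hψ s t).hasSum))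

open Classical in
-- This kernel encodes the Hilbert direct sum of the spaces of the `K i`. A finitely supported
-- vector meets finitely many blocks, so a finite sum of Schur products suffices.
theorem Matrix.PosSemidef.blockDiagonal_prod {I G : Type*} {K : I → Matrix G G ℂ}
    (hK : ∀ i, (K i).PosSemidef) :
    (Matrix.of fun s t : I × G => if s.1 = t.1 then K s.1 s.2 t.2 else 0).PosSemidef := by
  let A : I → Matrix (I × G) (I × G) ℂ := fun i =>
    Matrix.hadamard (Matrix.gram ℂ fun s : I × G => if s.1 = i then (1 : ℂ) else 0)
      ((K i).submatrix Prod.snd Prod.snd)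
  have hA (i : I) : (A i).PosSemidef :=
    (Matrix.posSemidef_gram_complex _).hadamard ((hK i).submatrix _)
  refine ⟨?_, fun x => ?_⟩
  · ext s t
    by_cases h : s.1 = t.1
    · simpa [h] using (hK t.1).isHermitian.apply s.2 t.2
    · simp [h, Ne.symm h]
  · have h := (Matrix.posSemidef_sum (x.support.image Prod.fst) fun i _ => hA i).2 x
    refine h.trans_eq (Finset.sum_congr rfl fun s hs => Finset.sum_congr rfl fun t _ => ?_)
    have hs : s.1 ∈ x.support.image Prod.fst := Finset.mem_image_of_mem _ hs
    have : (∑ i ∈ x.support.image Prod.fst, A i) s t =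
        if s.1 = t.1 then K s.1 s.2 t.2 else 0 := by
      rw [Matrix.sum_apply, Finset.sum_eq_single_of_mem s.1 hs]
      · simp [A, Matrix.gram_apply, eq_comm]
      · intro i _ hi
        simp [A, Matrix.gram_apply, Ne.symm hi]
    simp [this]

/-! ### From kernels to unitary representations. -/

/-- The space of finitely supported functions on `S` with the semi-inner product given by a
positive semidefinite kernel `K`. -/
@[nolint unusedArguments]
def KernelSpace {S : Type u} {K : Matrix S S ℂ} (_ : K.PosSemidef) : Type u := S →₀ ℂ

namespace KernelSpace

variable {S : Type u} {K : Matrix S S ℂ} (hK : K.PosSemidef)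

noncomputable instance : AddCommGroup (KernelSpace hK) := inferInstanceAs (AddCommGroup (S →₀ ℂ))
noncomputable instance : Module ℂ (KernelSpace hK) := inferInstanceAs (Module ℂ (S →₀ ℂ))

/-- An element of the kernel space as a finitely supported function. -/
noncomputable def toFinsupp : KernelSpace hK ≃ₗ[ℂ] (S →₀ ℂ) := LinearEquiv.refl ℂ _

/-- The semi-inner product defined by the kernel. -/
noncomputable abbrev core : PreInnerProductSpace.Core ℂ (KernelSpace hK) where
  inner x y := (toFinsupp hK x).sum fun s a => (toFinsupp hK y).sum fun t b => star a * K s t * b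
  conj_inner_symm x y := by
    rw [Finsupp.sum_comm]
    simp only [map_finsuppSum]
    refine Finsupp.sum_congr fun s _ => Finsupp.sum_congr fun t _ => ?_
    rw [← hK.isHermitian.apply]
    simp
    ring
  re_inner_nonneg x := (Complex.nonneg_iff.1 (hK.2 x)).1
  add_left x y z := by
    rw [map_add]
    refine Finsupp.sum_add_index' (by simp) ?_
    intro s a b
    rw [← Finsupp.sum_add]
    simp [add_mul]
  smul_left x y r := by
    rw [map_smul]
    refine (Finsupp.sum_smul_index (by simp)).trans ?_
    simp [Finsupp.mul_sum, mul_assoc]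

noncomputable instance : SeminormedAddCommGroup (KernelSpace hK) :=
  InnerProductSpace.Core.toSeminormedAddCommGroup (c := core hK)
noncomputable instance : InnerProductSpace ℂ (KernelSpace hK) :=
  InnerProductSpace.ofCore (core hK)

theorem inner_def (x y : KernelSpace hK) : ⟪x, y⟫_ℂ =
    (toFinsupp hK x).sum fun s a => (toFinsupp hK y).sum fun t b => star a * K s t * b := rfl

/-- The vector of the kernel space that corresponds to a point of `S`. -/
noncomputable def vec (s : S) : KernelSpace hK := (toFinsupp hK).symm (Finsupp.single s 1)

theorem inner_vec (s t : S) : ⟪vec hK s, vec hK t⟫_ℂ = K s t := by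
  rw [inner_def]
  simp [vec]

theorem span_range_vec : Submodule.span ℂ (Set.range (vec hK)) = ⊤ := by
  have h : vec hK = (Finsupp.basisSingleOne (R := ℂ) (ι := S)).map (toFinsupp hK).symm := by
    ext s
    simp [vec]
  rw [h, Module.Basis.span_eq]

/-- A permutation of `S` that preserves the kernel acts isometrically on the kernel space. -/
noncomputable def permute (σ : Equiv.Perm S) (hσ : ∀ s t, K (σ s) (σ t) = K s t) :
    KernelSpace hK ≃ₗᵢ[ℂ] KernelSpace hK :=
  ((toFinsupp hK).trans ((Finsupp.domLCongr σ).trans (toFinsupp hK).symm)).isometryOfInner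
    fun x y => by
      simp only [inner_def, LinearEquiv.trans_apply, LinearEquiv.apply_symm_apply,
        Finsupp.domLCongr_apply, Finsupp.domCongr_apply, Finsupp.equivMapDomain_eq_mapDomain]
      simp [Finsupp.sum_mapDomain_index_inj σ.injective, hσ]

theorem permute_vec (σ : Equiv.Perm S) (hσ : ∀ s t, K (σ s) (σ t) = K s t) (s : S) :
    permute hK σ hσ (vec hK s) = vec hK (σ s) := by
  simp [permute, vec]

end KernelSpace

open KernelSpace UniformSpace in
/-- A group of permutations that preserves a positive semidefinite kernel is represented by
unitary operators on the Hilbert space of the kernel. -/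
theorem Matrix.PosSemidef.exists_unitary_representation {Γ : Type*} [Group Γ] {S : Type u}
    {K : Matrix S S ℂ} (hK : K.PosSemidef) (ρ : Γ →* Equiv.Perm S)
    (hρ : ∀ g s t, K (ρ g s) (ρ g t) = K s t) :
    ∃ (H : Type u) (_ : NormedAddCommGroup H) (_ : InnerProductSpace ℂ H) (_ : CompleteSpace H)
      (π : Γ →* unitary (H →L[ℂ] H)) (v : S → H),
      (∀ s t, ⟪v s, v t⟫_ℂ = K s t) ∧ (∀ g s, (π g : H →L[ℂ] H) (v s) = v (ρ g s)) ∧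
      (Submodule.span ℂ (Set.range v)).topologicalClosure = ⊤ := by
  let v : S → Completion (KernelSpace hK) := fun s => (KernelSpace.vec hK s :)
  have hv : (Submodule.span ℂ (Set.range v)).topologicalClosure = ⊤ := by
    have h : Set.range v =
        (Completion.toComplL : KernelSpace hK →L[ℂ] _) '' Set.range (KernelSpace.vec hK) := by
      rw [← Set.range_comp]; rfl
    rw [h, ← ContinuousLinearMap.coe_coe, Submodule.span_image, span_range_vec,
      Submodule.map_top, ← Submodule.dense_iff_topologicalClosure_eq_top]
    exact Completion.denseRange_coe
  have hext {A B : Completion (KernelSpace hK) →L[ℂ] Completion (KernelSpace hK)}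
      (h : ∀ s, A (v s) = B (v s)) : A = B :=
    ContinuousLinearMap.ext_on (Submodule.dense_iff_topologicalClosure_eq_top.2 hv)
      (by rintro _ ⟨s, rfl⟩; exact h s)
  let L : Γ → Completion (KernelSpace hK) →L[ℂ] Completion (KernelSpace hK) := fun g =>
    ContinuousLinearMap.completion
      ((permute hK (ρ g) (hρ g)).toContinuousLinearEquiv : KernelSpace hK →L[ℂ] KernelSpace hK)
  have hL (g : Γ) (s : S) : L g (v s) = v (ρ g s) := by
    simp [L, v, permute_vec]
  have hL_mul (g h : Γ) : L (g * h) = L g * L h :=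
    hext fun s => by simp [hL]
  have hL_one : L 1 = 1 := hext fun s => by simp [hL]
  have hL_norm (g : Γ) (x) : ‖L g x‖ = ‖x‖ := by
    induction x using Completion.induction_on with
    | hp => exact isClosed_eq (by fun_prop) (by fun_prop)
    | ih x => simp [L]
  let π : Γ →* unitary (Completion (KernelSpace hK) →L[ℂ] Completion (KernelSpace hK)) :=
    { toFun g := ⟨L g, by
        -- An isometry has its adjoint as left inverse; invertibility of `L g` makes it two-sided.
        have h : star (L g) * L g = 1 := (L g).norm_map_iff_adjoint_comp_self.1 (hL_norm g)
        have hr : L g * L g⁻¹ = 1 := by rw [← hL_mul, mul_inv_cancel, hL_one]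
        have hs : star (L g) = L g⁻¹ := left_inv_eq_right_inv h hr
        exact ⟨h, hs ▸ hr⟩⟩
      map_one' := Subtype.ext hL_one
      map_mul' g h := Subtype.ext (hL_mul g h) }
  refine ⟨Completion (KernelSpace hK), inferInstance, inferInstance, inferInstance, π, v,
    fun s t => ?_, hL, hv⟩
  rw [Completion.inner_coe, inner_vec]

/-- A Hausdorff abelian group is unitarily representable if its topology is generated by continuous
positive definite functions. -/
theorem isUnitarilyRepresentable_of_posSemidef {G : Type u} [AddCommGroup G]
    [t : TopologicalSpace G] [IsTopologicalAddGroup G] [T1Space G]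
    (hG : ∀ U ∈ 𝓝 (0 : G), ∃ φ : G → ℝ, Continuous φ ∧ φ 0 = 1 ∧
      (Matrix.of fun g h => (φ (g - h) : ℂ)).PosSemidef ∧ ∃ δ > 0, ∀ g, 1 - φ g < δ → g ∈ U) :
    IsUnitarilyRepresentable G t := by
  classical
  -- All normalized continuous positive definite functions are used at once, one block each; `G`
  -- translates within the blocks.
  let I : Type u := {φ : G → ℝ // Continuous φ ∧ φ 0 = 1 ∧
    (Matrix.of fun g h => (φ (g - h) : ℂ)).PosSemidef}
  let ρ : Multiplicative G →* Equiv.Perm (I × G) :=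
    { toFun g := (Equiv.refl I).prodCongr (Equiv.addLeft g.toAdd)
      map_one' := by ext s <;> simp
      map_mul' g h := by ext s <;> simp [add_assoc] }
  obtain ⟨H, _, _, _, π, v, hv, hπ, hspan⟩ :=
    (Matrix.PosSemidef.blockDiagonal_prod fun φ : I => φ.2.2.2).exists_unitary_representation ρ
      (by intro g s t; simp [ρ])
  have hπv (g : G) (φ : I) (x : G) :
      (π (Multiplicative.ofAdd g) : H →L[ℂ] H) (v (φ, x)) = v (φ, g + x) := hπ _ _
  have hdist (φ : I) (x y : G) : ‖v (φ, x) - v (φ, y)‖ ^ 2 = 2 * (1 - φ.1 (x - y)) := by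
    have hn (z : G) : ‖v (φ, z)‖ ^ 2 = 1 := by
      rw [← inner_self_eq_norm_sq (𝕜 := ℂ), hv]
      simp [φ.2.2.1]
    rw [norm_sub_sq (𝕜 := ℂ), hn, hn, hv]
    simp
    ring
  have hcont (w : H) : Continuous fun g : G => (π (Multiplicative.ofAdd g) : H →L[ℂ] H) w := by
    have hcont' : ∀ w ∈ Submodule.span ℂ (Set.range v),
        Continuous fun g : G => (π (Multiplicative.ofAdd g) : H →L[ℂ] H) w := by
      intro w hw
      induction hw using Submodule.span_induction with
      | mem w hw =>
        obtain ⟨⟨φ, x⟩, rfl⟩ := hw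
        simp_rw [hπv]
        refine continuous_iff_continuousAt.2 fun g => tendsto_iff_norm_sub_tendsto_zero.2 ?_
        have h : Filter.Tendsto (fun g' => 2 * (1 - φ.1 ((g' + x) - (g + x)))) (𝓝 g) (𝓝 0) := by
          have := φ.2.1
          have hc : Continuous fun g' => 2 * (1 - φ.1 ((g' + x) - (g + x))) := by fun_prop
          simpa [φ.2.2.1] using hc.tendsto g
        simp_rw [← hdist] at h
        simpa using h.sqrt
      | zero => simpa using continuous_const
      | add w₁ w₂ _ _ h₁ h₂ =>
        simp only [map_add]
        exact h₁.add h₂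
      | smul c w _ h =>
        simp only [map_smul]
        exact h.const_smul c
    -- The operators are isometries, so approximating `w` from the dense span approximates its orbit
    -- map uniformly in `g`.
    refine continuous_of_uniform_approx_of_continuous fun V hV => ?_
    obtain ⟨ε, hε, hεV⟩ := Metric.mem_uniformity_dist.1 hV
    obtain ⟨w', hw', hww'⟩ := Metric.mem_closure_iff.1
      (show w ∈ (Submodule.span ℂ (Set.range v)).topologicalClosure from hspan ▸ trivial) ε hε
    refine ⟨_, hcont' w' hw', fun g => hεV ?_⟩
    rwa [dist_eq_norm, ← map_sub, Unitary.norm_map, ← dist_eq_norm]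
  refine ⟨H, inferInstance, inferInstance, inferInstance, π, ?_⟩
  let _ : TopologicalSpace (unitary (H →L[ℂ] H)) := strongOperatorTopology H
  have heval (w : H) : Continuous fun U : unitary (H →L[ℂ] H) => (U : H →L[ℂ] H) w :=
    (continuous_apply w).comp continuous_induced_dom
  have hnear (x : G) (U : Set G) (hU : U ∈ 𝓝 x) : ∃ w : H, ∃ δ > 0, ∀ g : G,
      ‖(π (Multiplicative.ofAdd g) : H →L[ℂ] H) w - (π (Multiplicative.ofAdd x) : H →L[ℂ] H) w‖ < δ
        → g ∈ U := by
    have hU' : (fun g => g + x) ⁻¹' U ∈ 𝓝 (0 : G) :=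
      (continuous_id.add continuous_const).continuousAt (by simpa using hU)
    obtain ⟨φ, hφ, hφ0, hφK, δ, hδ, hφU⟩ := hG _ hU'
    -- By `hdist`, moving this vector by less than `√(2 * δ)` means `1 - φ < δ`.
    refine ⟨v (⟨φ, hφ, hφ0, hφK⟩, 0), √(2 * δ), by positivity, fun g hg => ?_⟩
    rw [hπv, hπv, Real.lt_sqrt (norm_nonneg _), hdist] at hg
    simpa using hφU (g - x) (by simpa using hg)
  refine ⟨⟨le_antisymm ?_ ?_⟩, fun x y hxy => ?_⟩
  · exact continuous_iff_le_induced.1 (continuous_induced_rng.2 (continuous_pi hcont))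
  · refine le_of_nhds_le_nhds fun x U hU => ?_
    obtain ⟨w, δ, hδ, hw⟩ := hnear x U hU
    rw [nhds_induced]
    refine Filter.mem_of_superset (Filter.preimage_mem_comap
      ((heval w).continuousAt (Metric.ball_mem_nhds _ hδ))) fun g hg => hw g ?_
    rw [← dist_eq_norm]
    exact hg
  · by_contra hne
    obtain ⟨w, δ, hδ, hw⟩ := hnear y {x}ᶜ (isOpen_compl_singleton.mem_nhds (Ne.symm hne))
    refine hw x ?_ rfl
    simpa [hxy] using hδ

/-! ### Approximation of compact sets by cubes. -/

theorem ContinuousMap.exists_partition_approx {Ω : Type*} [TopologicalSpace Ω] [CompactSpace Ω]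
    [T2Space Ω] {K : Set C(Ω, ℂ)} (hK : IsCompact K) {δ : ℝ} (hδ : 0 < δ) :
    ∃ (m : ℕ) (p : Fin m → C(Ω, ℂ)),
      (∀ c : Fin m → ℂ, ∀ R, 0 ≤ R → (∀ i, ‖c i‖ ≤ R) → ‖∑ i, c i • p i‖ ≤ R) ∧
      ∀ R, 0 ≤ R → ∀ f ∈ K, ‖f‖ ≤ R →
        ∃ c : Fin m → ℂ, (∀ i, ‖c i‖ ≤ R) ∧ ‖f - ∑ i, c i • p i‖ ≤ δ := by
  classical
  have := isCompact_iff_compactSpace.1 hK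
  -- Continuity of `F` is equicontinuity of `K`: on each `U x`, every `f ∈ K` varies by less than
  -- `δ` from its value at `x`. The coefficients of `f` are its values at the centres.
  let F : Ω → C(K, ℂ) := fun x => ⟨fun f => f.1 x, by fun_prop⟩
  have hF : Continuous F := ContinuousMap.continuous_of_continuous_uncurry F (by
    show Continuous fun q : Ω × K => q.2.1 q.1
    fun_prop)
  let U : Ω → Set Ω := fun x => F ⁻¹' Metric.ball (F x) δ
  have hU (x : Ω) : IsOpen (U x) := Metric.isOpen_ball.preimage hF
  obtain ⟨t, ht⟩ := isCompact_univ.elim_finite_subcover U hU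
    fun x _ => Set.mem_iUnion.2 ⟨x, Metric.mem_ball_self hδ⟩
  obtain ⟨q, hq⟩ := PartitionOfUnity.exists_isSubordinate isClosed_univ (fun x : t => U x)
    (fun x => hU x) (by simpa [Set.iUnion_subtype] using ht)
  let e := t.equivFin
  have hsum (y : Ω) : ∑ i, q (e.symm i) y = 1 := by
    rw [e.symm.sum_comp fun x => q x y, ← finsum_eq_sum_of_fintype]
    exact q.sum_eq_one (Set.mem_univ y)
  let p : Fin t.card → C(Ω, ℂ) := fun i =>
    ⟨fun y => (q (e.symm i) y : ℂ), by fun_prop⟩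
  have hcube (c : Fin t.card → C(Ω, ℂ)) (R : ℝ) (hR : 0 ≤ R)
      (hc : ∀ i y, q (e.symm i) y ≠ 0 → ‖c i y‖ ≤ R) : ‖∑ i, c i * p i‖ ≤ R := by
    refine (ContinuousMap.norm_le _ hR).2 fun y => ?_
    rw [ContinuousMap.coe_sum, Finset.sum_apply]
    calc ‖∑ i, (c i * p i) y‖ ≤ ∑ i, ‖(c i * p i) y‖ := norm_sum_le _ _
      _ ≤ ∑ i, R * q (e.symm i) y := Finset.sum_le_sum fun i _ => by
        have h0 := q.nonneg (e.symm i) y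
        by_cases h : q (e.symm i) y = 0
        · simp [p, h]
        · simpa [p, abs_of_nonneg h0] using mul_le_mul_of_nonneg_right (hc i y h) h0
      _ = R := by rw [← Finset.mul_sum, hsum, mul_one]
  refine ⟨t.card, p, fun c R hR hc => ?_, fun R hR f hf hfR => ?_⟩
  · convert hcube (fun i => ContinuousMap.const Ω (c i)) R hR fun i y _ => by simpa using hc i
    ext; simp
  · refine ⟨fun i => f (e.symm i), fun i => (f.norm_coe_le_norm _).trans hfR, ?_⟩
    convert hcube (fun i => f - ContinuousMap.const Ω (f (e.symm i))) δ hδ.le fun i y hy => ?_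
    · ext y
      have h1 : ∑ i, (q (e.symm i) y : ℂ) = 1 := by exact_mod_cast hsum y
      simp [ContinuousMap.coe_sum, sub_mul, Finset.sum_sub_distrib, ← Finset.mul_sum, p, h1]
    · have hyU : y ∈ U (e.symm i) := hq (e.symm i) (subset_tsupport _ hy)
      have := (ContinuousMap.dist_lt_iff hδ).1 (Metric.mem_ball.1 hyU) ⟨f, hf⟩
      rw [dist_eq_norm] at this
      exact this.le

/-- A Banach space has `ℓ^∞`-approximations if the compact sets are approximated by finite
dimensional parallelepipeds that are contractive images of balls of `ℓ^∞(m)`. -/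
def HasSupApproximation (E : Type*) [NormedAddCommGroup E] [NormedSpace ℂ E] : Prop :=
  ∀ K : Set E, IsCompact K → ∀ δ : ℝ, 0 < δ → ∃ (m : ℕ) (p : Fin m → E),
    (∀ c : Fin m → ℂ, ∀ R, 0 ≤ R → (∀ i, ‖c i‖ ≤ R) → ‖∑ i, c i • p i‖ ≤ R) ∧
    ∀ R, 0 ≤ R → ∀ f ∈ K, ‖f‖ ≤ R →
      ∃ c : Fin m → ℂ, (∀ i, ‖c i‖ ≤ R) ∧ ‖f - ∑ i, c i • p i‖ ≤ δ

theorem ContinuousMap.hasSupApproximation (Ω : Type*) [TopologicalSpace Ω] [CompactSpace Ω]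
    [T2Space Ω] : HasSupApproximation C(Ω, ℂ) :=
  fun _ hK _ hδ => ContinuousMap.exists_partition_approx hK hδ

theorem HasSupApproximation.of_linearIsometryEquiv {E F : Type*} [NormedAddCommGroup E]
    [NormedSpace ℂ E] [NormedAddCommGroup F] [NormedSpace ℂ F] (hE : HasSupApproximation E)
    (e : F ≃ₗᵢ[ℂ] E) : HasSupApproximation F := by
  intro K hK δ hδ
  obtain ⟨m, p, hp, happ⟩ := hE (e '' K) (hK.image e.continuous) δ hδ
  have he (c : Fin m → ℂ) : ∑ i, c i • e.symm (p i) = e.symm (∑ i, c i • p i) := by simp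
  refine ⟨m, fun i => e.symm (p i), fun c R hR hc => ?_, fun R hR f hf hfR => ?_⟩
  · rw [he, e.symm.norm_map]
    exact hp c R hR hc
  · obtain ⟨c, hc, hfc⟩ := happ R hR (e f) ⟨f, hf, rfl⟩ (by rwa [e.norm_map])
    refine ⟨c, hc, ?_⟩
    rw [he, ← e.norm_map, map_sub, e.apply_symm_apply]
    exact hfc

theorem CommCStarAlgebra.hasSupApproximation (B : Type*) [CommCStarAlgebra B] :
    HasSupApproximation B :=
  (ContinuousMap.hasSupApproximation (WeakDual.characterSpace ℂ B)).of_linearIsometryEquiv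
    { (gelfandStarTransform B).toAlgEquiv.toLinearEquiv with
      norm_map' := (gelfandTransform_isometry B).norm_map_of_map_zero (map_zero _) }

/-! ### Seminorms of `ℓ¹` type. -/

theorem HasSupApproximation.exists_hasSum {E : Type*} [NormedAddCommGroup E] [NormedSpace ℂ E]
    [CompleteSpace E] (hE : HasSupApproximation E) {K : Set E} (hK : IsCompact K) :
    ∃ (r : ℕ → ℝ) (m : ℕ → ℕ) (p : ∀ n, Fin (m n) → E), (∀ n, 0 ≤ r n) ∧ Summable r ∧
      (∀ n, ∀ c : Fin (m n) → ℂ, ∀ R, 0 ≤ R → (∀ i, ‖c i‖ ≤ R) → ‖∑ i, c i • p n i‖ ≤ R) ∧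
      ∀ f ∈ K, ∃ c : ∀ n, Fin (m n) → ℂ, (∀ n i, ‖c n i‖ ≤ r n) ∧
        HasSum (fun n => ∑ i, c n i • p n i) f := by
  obtain ⟨R, hR, hKR⟩ := hK.isBounded.exists_pos_norm_le
  let r : ℕ → ℝ := fun n => R * (1 / 2) ^ n
  have hr (n : ℕ) : 0 < r n := by positivity
  have hrs : Summable r := summable_geometric_two.mul_left R
  choose m p hp happ using fun (K : {K : Set E // IsCompact K}) (n : ℕ) =>
    hE K.1 K.2 (r (n + 1)) (hr _)
  -- The possible remainders after one approximation again form a compact set, now of radius `r (n +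
  -- 1)`, so the `p` of each stage serve all of `K`.
  let next (n : ℕ) (K : {K : Set E // IsCompact K}) : {K : Set E // IsCompact K} :=
    ⟨(fun q : E × (Fin (m K n) → ℂ) => q.1 - ∑ i, q.2 i • p K n i) ''
        (K.1 ×ˢ Set.univ.pi fun _ => Metric.closedBall 0 (r n)) ∩ Metric.closedBall 0 (r (n + 1)),
      ((K.2.prod (isCompact_univ_pi fun _ => isCompact_closedBall _ _)).image
        (by fun_prop)).inter_right Metric.isClosed_closedBall⟩
  let Ks : ℕ → {K : Set E // IsCompact K} := fun n => Nat.rec ⟨K, hK⟩ next n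
  have hKs (n : ℕ) : ∀ f ∈ (Ks n).1, ‖f‖ ≤ r n := by
    cases n with
    | zero => exact fun f hf => by simpa [r] using hKR f hf
    | succ n => exact fun f hf => by simpa using hf.2
  have hstep (n : ℕ) (f : (Ks n).1) : ∃ c : Fin (m (Ks n) n) → ℂ, (∀ i, ‖c i‖ ≤ r n) ∧
      f.1 - ∑ i, c i • p (Ks n) n i ∈ (Ks (n + 1)).1 := by
    obtain ⟨c, hc, hfc⟩ := happ (Ks n) n (r n) (hr n).le f.1 f.2 (hKs n _ f.2)
    exact ⟨c, hc, ⟨(f.1, c), ⟨f.2, fun i _ => by simpa using hc i⟩, rfl⟩, by simpa using hfc⟩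
  choose c hc hfc using hstep
  refine ⟨r, fun n => m (Ks n) n, fun n => p (Ks n) n, fun n => (hr n).le, hrs,
    fun n => hp (Ks n) n, fun f hf => ?_⟩
  let fs : ∀ n, (Ks n).1 := fun n => Nat.rec ⟨f, hf⟩ (fun n f => ⟨_, hfc n f⟩) n
  refine ⟨fun n => c n (fs n), fun n => hc n (fs n), ?_⟩
  have hsum : Summable fun n => ‖∑ i, c n (fs n) i • p (Ks n) n i‖ :=
    hrs.of_nonneg_of_le (fun _ => norm_nonneg _) fun n => hp _ _ _ _ (hr n).le (hc n (fs n))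
  rw [hasSum_iff_tendsto_nat_of_summable_norm hsum]
  have hpart (n : ℕ) : ∑ k ∈ Finset.range n, ∑ i, c k (fs k) i • p (Ks k) k i = f - (fs n).1 := by
    induction n with
    | zero => simp [fs]
    | succ n ih =>
      have : (fs (n + 1)).1 = (fs n).1 - ∑ i, c n (fs n) i • p (Ks n) n i := rfl
      rw [Finset.sum_range_succ, ih, this]
      abel
  simp_rw [hpart]
  have h0 : Filter.Tendsto (fun n => (fs n).1) Filter.atTop (𝓝 0) :=
    squeeze_zero_norm (fun n => hKs n _ (fs n).2) hrs.tendsto_atTop_zero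
  simpa using h0.const_sub f

theorem Complex.exists_norm_le_one_mul_eq_norm (z : ℂ) : ∃ u : ℂ, ‖u‖ ≤ 1 ∧ u * z = ‖z‖ := by
  rcases eq_or_ne z 0 with rfl | hz
  · exact ⟨0, by simp⟩
  · have hz' : (‖z‖ : ℂ) ≠ 0 := by simpa using hz
    refine ⟨starRingEnd ℂ z / ‖z‖, by simp [hz], ?_⟩
    rw [div_mul_eq_mul_div, Complex.conj_mul', div_eq_iff hz', sq]

theorem HasSupApproximation.exists_summable_abs {E : Type*} [NormedAddCommGroup E]
    [NormedSpace ℂ E] [CompleteSpace E] (hE : HasSupApproximation E) {K : Set E}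
    (hK : IsCompact K) :
    ∃ (L : Set E) (J : Type) (ψ : StrongDual ℂ E →+ J → ℝ), IsCompact L ∧
      (∀ θ, Summable fun j => |ψ θ j|) ∧
      (∀ θ : StrongDual ℂ E, ∀ ε, (∀ a ∈ L, ‖θ a‖ ≤ ε) → ∑' j, |ψ θ j| ≤ 2 * ε) ∧
      ∀ θ : StrongDual ℂ E, ∀ a ∈ K, ‖θ a‖ ≤ ∑' j, |ψ θ j| := by
  obtain ⟨r, m, p, hr, hrs, hp, hK⟩ := hE.exists_hasSum hK
  let U := ∀ n, Fin (m n) → Metric.closedBall (0 : ℂ) 1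
  -- By Tychonoff and uniform convergence the range of `T` is compact; it will be `L`.
  let T : U → E := fun u => ∑' n, ∑ i, (r n * (u n i : ℂ)) • p n i
  have hbound (u : U) (n : ℕ) : ‖∑ i, (r n * (u n i : ℂ)) • p n i‖ ≤ r n := by
    refine hp n _ _ (hr n) fun i => ?_
    have hu : ‖(u n i : ℂ)‖ ≤ 1 := mem_closedBall_zero_iff.1 (u n i).2
    simpa [abs_of_nonneg (hr n)] using mul_le_mul_of_nonneg_left hu (hr n)
  have hT : Continuous T := continuous_tsum (fun n => by fun_prop) hrs fun n u => hbound u n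
  let b : StrongDual ℂ E → ℕ → ℝ := fun θ n => ∑ i, r n * ‖θ (p n i)‖
  have hb (θ : StrongDual ℂ E) : ∃ u : U, HasSum (b θ) ‖θ (T u)‖ := by
    -- Rotating every term to be nonnegative attains the supremum of `‖θ‖` on `L`, which equals the
    -- sum of `b θ`.
    choose v hv1 hv using fun n i => Complex.exists_norm_le_one_mul_eq_norm (θ (p n i))
    let u : U := fun n i => ⟨v n i, by simpa using hv1 n i⟩
    have hs : HasSum (fun n => ((b θ n : ℝ) : ℂ)) (θ (T u)) := by
      have he : (fun n => ((b θ n : ℝ) : ℂ)) = fun n => θ (∑ i, (r n * (u n i : ℂ)) • p n i) := by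
        ext n
        simp [b, u, mul_assoc, hv]
      rw [he]
      exact (Summable.of_norm_bounded hrs (hbound u)).hasSum.mapL θ
    have hs' : HasSum (b θ) (θ (T u)).re := by simpa using Complex.hasSum_re hs
    refine ⟨u, ?_⟩
    rw [← hs.tsum_eq, ← Complex.ofReal_tsum, hs'.tsum_eq, Complex.norm_real, Real.norm_of_nonneg]
    · exact hs'
    · exact hs'.nonneg fun n => Finset.sum_nonneg fun i _ => mul_nonneg (hr n) (norm_nonneg _)
  have hbs (θ : StrongDual ℂ E) : Summable (b θ) := (hb θ).choose_spec.summable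
  -- Real and imaginary parts are separate coordinates, making `ψ` real; this costs the factor 2.
  let J := Σ n, Fin (m n) × Bool
  let ψ : StrongDual ℂ E →+ J → ℝ :=
    { toFun θ j := r j.1 * cond j.2.2 (θ (p j.1 j.2.1)).re (θ (p j.1 j.2.1)).im
      map_zero' := by ext ⟨n, i, b⟩; cases b <;> simp
      map_add' θ θ' := by ext ⟨n, i, b⟩; cases b <;> simp [mul_add] }
  have hψ (θ : StrongDual ℂ E) (n : ℕ) : ∑ q, |ψ θ ⟨n, q⟩| =
      ∑ i, r n * (|(θ (p n i)).re| + |(θ (p n i)).im|) := by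
    rw [Fintype.sum_prod_type]
    simp [ψ, abs_mul, abs_of_nonneg (hr n), mul_add]
  have hψ_le (θ : StrongDual ℂ E) (n : ℕ) : ∑ q, |ψ θ ⟨n, q⟩| ≤ 2 * b θ n := by
    rw [hψ, Finset.mul_sum]
    refine Finset.sum_le_sum fun i _ => ?_
    nlinarith [hr n, Complex.abs_re_le_norm (θ (p n i)), Complex.abs_im_le_norm (θ (p n i)),
      mul_le_mul_of_nonneg_left (Complex.abs_re_le_norm (θ (p n i))) (hr n),
      mul_le_mul_of_nonneg_left (Complex.abs_im_le_norm (θ (p n i))) (hr n)]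
  have hle_ψ (θ : StrongDual ℂ E) (n : ℕ) : b θ n ≤ ∑ q, |ψ θ ⟨n, q⟩| := by
    rw [hψ]
    exact Finset.sum_le_sum fun i _ =>
      mul_le_mul_of_nonneg_left (Complex.norm_le_abs_re_add_abs_im _) (hr n)
  have hψn (θ : StrongDual ℂ E) : Summable fun n => ∑ q, |ψ θ ⟨n, q⟩| :=
    ((hbs θ).mul_left 2).of_nonneg_of_le (fun n => Finset.sum_nonneg fun q _ => abs_nonneg _)
      (hψ_le θ)
  have hψs (θ : StrongDual ℂ E) : Summable fun j => |ψ θ j| :=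
    (summable_sigma_of_nonneg fun _ => abs_nonneg _).2
      ⟨fun n => (hasSum_fintype _).summable, by simpa only [tsum_fintype] using hψn θ⟩
  have htsum (θ : StrongDual ℂ E) : ∑' j, |ψ θ j| = ∑' n, ∑ q, |ψ θ ⟨n, q⟩| := by
    rw [(hψs θ).tsum_sigma]
    simp only [tsum_fintype]
  refine ⟨Set.range T, J, ψ, isCompact_range hT, hψs, fun θ ε hε => ?_, fun θ a ha => ?_⟩
  · obtain ⟨u, hu⟩ := hb θ
    rw [htsum]
    refine (Summable.tsum_le_tsum (hψ_le θ) (hψn θ) ((hbs θ).mul_left 2)).trans ?_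
    rw [tsum_mul_left, hu.tsum_eq]
    exact mul_le_mul_of_nonneg_left (hε _ ⟨u, rfl⟩) two_pos.le
  · obtain ⟨c, hc, hca⟩ := hK a ha
    rw [htsum, ← (hca.mapL θ).tsum_eq]
    refine tsum_of_norm_bounded (hψn θ).hasSum fun n => le_trans ?_ (hle_ψ θ n)
    simp only [map_sum, map_smul]
    refine (norm_sum_le _ _).trans (Finset.sum_le_sum fun i _ => ?_)
    rw [smul_eq_mul, norm_mul]
    exact mul_le_mul_of_nonneg_right (hc n i) (norm_nonneg _)

/-! ### The topology `τ_k` and the conclusion. -/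

section tauK

variable {X E : Type*} [TopologicalSpace E]

theorem hasBasis_nhds_tauK (β : X → E → ℂ) (x : X) :
    (@nhds X (tauK β) x).HasBasis (fun q : Set E × ℝ => IsCompact q.1 ∧ 0 < q.2)
      fun q => {y | ∀ a ∈ q.1, ‖β y a - β x a‖ < q.2} := by
  rw [nhds_induced]
  refine ((UniformOnFun.hasBasis_nhds_of_basis E ℂ {K : Set E | IsCompact K}
    (UniformOnFun.ofFun _ (β x)) ⟨∅, isCompact_empty⟩
    (directedOn_of_sup_mem fun _ _ h h' => h.union h') Metric.uniformity_basis_dist).comap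
      fun y => UniformOnFun.ofFun {K : Set E | IsCompact K} (β y)).to_hasBasis
    (fun q hq => ⟨q, hq, fun y hy a ha => ?_⟩) fun q hq => ⟨q, hq, fun y hy a ha => ?_⟩
  · exact (dist_eq_norm _ _).trans_lt (hy a ha)
  · exact (dist_eq_norm _ _).symm.trans_lt (hy a ha)

theorem isTopologicalAddGroup_tauK [AddCommGroup X] (β : X →+ E → ℂ) :
    @IsTopologicalAddGroup X (tauK β) _ :=
  topologicalAddGroup_induced
    ({ toFun x := UniformOnFun.ofFun {K : Set E | IsCompact K} (β x)
       map_zero' := congrArg _ (map_zero β)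
       map_add' x y := congrArg _ (map_add β x y) } : X →+ UniformOnFun E ℂ {K | IsCompact K})

theorem t2Space_tauK {β : X → E → ℂ} (hβ : Function.Injective β) : @T2Space X (tauK β) := by
  let _ : TopologicalSpace X := tauK β
  have := UniformOnFun.t2Space_of_covering (β := ℂ) (𝔖 := {K : Set E | IsCompact K})
    (Set.eq_univ_of_forall fun a => ⟨{a}, isCompact_singleton, rfl⟩)
  exact T2Space.of_injective_continuous
    (f := fun x => UniformOnFun.ofFun {K : Set E | IsCompact K} (β x)) hβ continuous_induced_dom

end tauK

theorem isUnitarilyRepresentable_tauK {E : Type*} [NormedAddCommGroup E] [NormedSpace ℂ E]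
    [CompleteSpace E] (hE : HasSupApproximation E) {G : Type u} [AddCommGroup G]
    (θ : G →+ StrongDual ℂ E) (hθ : Function.Injective θ) :
    IsUnitarilyRepresentable G (tauK fun g a => θ g a) := by
  let β : G →+ E → ℂ :=
    { toFun g a := θ g a
      map_zero' := by ext; simp
      map_add' g h := by ext; simp }
  let _ : TopologicalSpace G := tauK β
  have : IsTopologicalAddGroup G := isTopologicalAddGroup_tauK β
  have : T2Space G := t2Space_tauK (β := β) fun g h hgh => hθ (DFunLike.coe_injective hgh)
  refine isUnitarilyRepresentable_of_posSemidef fun V hV => ?_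
  obtain ⟨⟨K, ε⟩, ⟨hK, hε⟩, hKV⟩ := (hasBasis_nhds_tauK β 0).mem_iff.1 hV
  obtain ⟨L, J, ψ, hL, hψs, hψL, hψK⟩ := hE.exists_summable_abs hK
  let N : G → ℝ := fun g => ∑' j, |ψ (θ g) j|
  have hN0 : N 0 = 0 := by simp [N]
  have hN_sub (g h : G) : N (g - h) = ∑' j, |ψ (θ g) j - ψ (θ h) j| := by simp [N]
  have hN_tri (g h : G) : N g ≤ N (g - h) + N h := by
    rw [← (hψs _).tsum_add (hψs _)]
    refine Summable.tsum_le_tsum (fun j => ?_) (hψs _) ((hψs _).add (hψs _))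
    have := abs_add_le (ψ (θ (g - h)) j) (ψ (θ h) j)
    simpa using this
  have hN_neg (g : G) : N (-g) = N g := by simp [N]
  have hN_cont : Continuous N := by
    refine continuous_iff_continuousAt.2 fun h => Metric.tendsto_nhds.2 fun η hη => ?_
    -- With the factor 2 in `hψL`, the radius `η / 3` leaves `2η/3 < η`.
    have hmem := (hasBasis_nhds_tauK β h).mem_of_mem (i := (L, η / 3)) ⟨hL, by positivity⟩
    filter_upwards [hmem] with g hg
    have hle : N (g - h) ≤ 2 * (η / 3) := hψL _ _ fun a ha => by
      have := (hg a ha).le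
      simpa [β] using this
    have h1 := hN_tri g h
    have h2 := hN_tri h g
    rw [← neg_sub, hN_neg] at h2
    rw [Real.dist_eq, abs_lt]
    constructor <;> linarith
  -- With this `δ`, `1 - exp (-N g) < δ` says exactly `N g < ε`.
  refine ⟨fun g => Real.exp (-N g), by fun_prop, by simp [hN0], ?_, 1 - Real.exp (-ε), ?_,
    fun g hg => hKV fun a ha => ?_⟩
  · simp_rw [hN_sub]
    exact posSemidef_exp_neg_tsum_abs_sub (fun g => ψ (θ g)) fun g h => by
      simpa using hψs (θ (g - h))
  · simpa using hε
  · have hlt : N g < ε := by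
      have : Real.exp (-ε) < Real.exp (-N g) := by linarith
      simpa using this
    have := (hψK (θ g) a ha).trans_lt hlt
    simpa [β] using this

/-- Compact sets are carried both ways by `r` and `i`. It transfers `tauK` from an algebra to its
unitization. -/
theorem tauK_comp_eq {X E F : Type*} [TopologicalSpace E] [TopologicalSpace F] (β : X → E → ℂ)
    {r : F → E} {i : E → F} (hr : Continuous r) (hi : Continuous i)
    (hri : Function.LeftInverse r i) : tauK (fun x a => β x (r a)) = tauK β := by
  refine TopologicalSpace.ext_nhds fun x => le_antisymm ?_ ?_
  · refine (hasBasis_nhds_tauK _ x).ge_iff.2 fun q hq => ?_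
    refine Filter.mem_of_superset ((hasBasis_nhds_tauK _ x).mem_of_mem (i := (i '' q.1, q.2))
      ⟨hq.1.image hi, hq.2⟩) fun y hy a ha => ?_
    simpa [hri a] using hy (i a) ⟨a, ha, rfl⟩
  · refine (hasBasis_nhds_tauK _ x).ge_iff.2 fun q hq => ?_
    exact Filter.mem_of_superset ((hasBasis_nhds_tauK _ x).mem_of_mem (i := (r '' q.1, q.2))
      ⟨hq.1.image hr, hq.2⟩) fun y hy a ha => hy (r a) ⟨a, ha, rfl⟩

theorem isUnitarilyRepresentable_dual (A : Type*) [NonUnitalCommCStarAlgebra A] :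
    IsUnitarilyRepresentable (StrongDual ℂ A)
      (tauK (fun (φ : StrongDual ℂ A) (a : A) => φ a)) := by
  let snd : Unitization ℂ A →L[ℂ] A :=
    { toFun x := x.snd
      map_add' := Unitization.snd_add
      map_smul' := Unitization.snd_smul
      cont := Unitization.continuous_snd }
  let θ : StrongDual ℂ A →+ StrongDual ℂ (Unitization ℂ A) :=
    { toFun φ := φ.comp snd
      map_zero' := by ext; simp
      map_add' φ φ' := by ext; simp }
  have hθ : Function.Injective θ := fun φ φ' h => by
    ext a
    simpa [θ, snd] using congrArg (fun f : StrongDual ℂ (Unitization ℂ A) => f a) h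
  rw [← tauK_comp_eq (fun (φ : StrongDual ℂ A) (a : A) => φ a) snd.continuous
    Unitization.continuous_inr fun a => Unitization.snd_inr ℂ a]
  exact isUnitarilyRepresentable_tauK (CommCStarAlgebra.hasSupApproximation _) θ hθ

theorem isUnitarilyRepresentable_predual (M : Type*) [CommCStarAlgebra M] (X : Type*)
    [NormedAddCommGroup X] [NormedSpace ℂ X] (e : StrongDual ℂ X ≃ₗᵢ[ℂ] M) :
    IsUnitarilyRepresentable X (tauK (fun (x : X) (m : M) => e.symm m x)) := by
  let θ : X →+ StrongDual ℂ M :=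
    { toFun x := (NormedSpace.inclusionInDoubleDual ℂ X x).comp
        (e.symm.toContinuousLinearEquiv : M →L[ℂ] StrongDual ℂ X)
      map_zero' := by ext; simp
      map_add' x y := by ext; simp }
  refine isUnitarilyRepresentable_tauK (CommCStarAlgebra.hasSupApproximation M) θ fun x y h => ?_
  -- Functionals on `X` separate points, and `e` makes all of them available in `M`.
  refine (NormedSpace.inclusionInDoubleDualLi ℂ (E := X)).injective ?_
  ext f
  have := congrArg (fun φ : StrongDual ℂ M => φ (e f)) h
  change f x = f y
  simpa [θ] using this

theorem isUnitarilyRepresentable_vonNeumannPredual {H : Type*} [NormedAddCommGroup H]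
    [InnerProductSpace ℂ H] [CompleteSpace H] (M : VonNeumannAlgebra H)
    (hM : ∀ a ∈ M, ∀ b ∈ M, a * b = b * a) :
    IsUnitarilyRepresentable (vonNeumannPredual M)
      (tauK (fun (φ : vonNeumannPredual M) (a : M.toStarSubalgebra) =>
        (φ : StrongDual ℂ M.toStarSubalgebra) a)) := by
  -- A double commutant is norm closed, which makes `M` a C⋆-algebra.
  have : IsClosed (M.toStarSubalgebra : Set (H →L[ℂ] H)) := by
    rw [VonNeumannAlgebra.coe_toStarSubalgebra, ← M.centralizer_centralizer]
    exact Set.isClosed_centralizer _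
  let _ : CommCStarAlgebra M.toStarSubalgebra :=
    { (inferInstance : CStarAlgebra M.toStarSubalgebra) with
      mul_comm a b := Subtype.ext (hM a a.2 b b.2) }
  let θ : vonNeumannPredual M →+ StrongDual ℂ M.toStarSubalgebra :=
    (vonNeumannPredual M).subtype.toAddMonoidHom
  have hθ : Function.Injective θ := (vonNeumannPredual M).subtype_injective
  exact isUnitarilyRepresentable_tauK (CommCStarAlgebra.hasSupApproximation M.toStarSubalgebra) θ hθ

end

/-- The three parts concern: the dual of a commutative C⋆-algebra, unital or not; the predual of a
commutative von Neumann algebra in the abstract sense (a C⋆-algebra `M` that is, through `e`, the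
dual of a Banach space `X`); and the predual of a commutative von Neumann algebra in the concrete
sense (an algebra of operators that is its own double commutant). -/
theorem corollary3p5 :
    (∀ (A : Type*) [NonUnitalCommCStarAlgebra A],
      IsUnitarilyRepresentable (StrongDual ℂ A)
        (tauK (fun (φ : StrongDual ℂ A) (a : A) => φ a))) ∧
    (∀ (M : Type*) [CommCStarAlgebra M] (X : Type*) [NormedAddCommGroup X] [NormedSpace ℂ X]
      [CompleteSpace X] (e : StrongDual ℂ X ≃ₗᵢ[ℂ] M),
      IsUnitarilyRepresentable X (tauK (fun (x : X) (m : M) => e.symm m x))) ∧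
    (∀ (H : Type*) [NormedAddCommGroup H] [InnerProductSpace ℂ H] [CompleteSpace H]
      (M : VonNeumannAlgebra H), (∀ a ∈ M, ∀ b ∈ M, a * b = b * a) →
      IsUnitarilyRepresentable (vonNeumannPredual M)
        (tauK (fun (φ : vonNeumannPredual M) (a : M.toStarSubalgebra) =>
          (φ : StrongDual ℂ M.toStarSubalgebra) a))) := by
  refine ⟨fun A _ => isUnitarilyRepresentable_dual A, ?_, ?_⟩
  · intro M _ X _ _ _ e
    exact isUnitarilyRepresentable_predual M X e
  · intro H _ _ _ M hM
    exact isUnitarilyRepresentable_vonNeumannPredual M hM
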